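/- Let $K$ be a field, let $k\ge 2$, and let $G$ be a finite complete $k$-partite graph: its vertex set $\{v_1,\dots,v_n\}$ is partitioned into $k$ nonempty classes $V_1,\dots,V_k$, and $\{u,v\}$ is an edge if and only if $u$ and $v$ lie in different classes. Let $S=K[x_1,\dots,x_n]$ and let $I=(x_ix_j : \{v_i,v_j\}\in E(G))\subset S$ be the edge ideal of $G$, with its standard $\mathbb Z^n$-grading. Then Stanley's conjecture holds for $I$, that is, $$\operatorname{sdepth}(I)\ \ge\ \operatorname{depth}(I).$$ Here $\operatorname{depth}(I)$ is the maximal length of an $I$-regular sequence in the ideal $(x_1,\dots,x_n)$, where $I$ is regarded as an $S$-module. A Stanley decomposition of $I$ is a finite direct sum decomposition of $K$-vector spaces $\mathcal D: I=\bigoplus_{i=1}^r u_iK[Z_i]$ with $u_i\in I$ homogeneous, $Z_i\subseteq\{x_1,\dots,x_n\}$, and each $u_iK[Z_i]=\{u_if: f\in K[Z_i]\}$ a free $K[Z_i]$-module with basis $u_i$. One sets $\operatorname{sdepth}(\mathcal D)=\min_i|Z_i|$, and $\operatorname{sdepth}(I)$ is the maximum of $\operatorname{sdepth}(\mathcal D)$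 over all Stanley decompositions $\mathcal D$ of $I$. -/

import Mathlib

noncomputable section

/-- `G` is complete `k`-partite: the vertex set is partitioned into `k` nonempty classes
`P 0, …, P (k - 1)`, and the edges are exactly the pairs `{u, v}` with `u`, `v` in distinct
classes. -/
def IsCompleteKPartite {V : Type*} (k : ℕ) (G : SimpleGraph V) : Prop :=
  ∃ P : Fin k → Set V,
    (∀ i, (P i).Nonempty) ∧
    (∀ i j, i ≠ j → Disjoint (P i) (P j)) ∧
    (⋃ i, P i) = Set.univ ∧
    ∀ u v, G.Adj u v ↔ ∃ i j, i ≠ j ∧ u ∈ P i ∧ v ∈ P j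

/-- The edge ideal of `G` in the polynomial ring `K[x_v : v ∈ V]`, generated by the products
`x_u x_v` over the edges `{u, v}` of `G`. -/
def edgeIdeal (K : Type*) [Field K] {V : Type*} (G : SimpleGraph V) :
    Ideal (MvPolynomial V K) :=
  Ideal.span {f | ∃ u v, G.Adj u v ∧ f = MvPolynomial.X u * MvPolynomial.X v}

/-- The multigraded component of degree `a ∈ ℤ^V` of an ideal `I` of `K[x_v : v ∈ V]`: the
elements of `I` all of whose monomials have exponent vector `a` (so it is zero if `a` has a
negative entry). For a monomial ideal `I` this is its standard `ℤ^V`-grading. -/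
def idealGrading {K : Type*} [Field K] {V : Type*} (I : Ideal (MvPolynomial V K))
    (a : V → ℤ) : Submodule K I where
  carrier := {f | ∀ b ∈ (f : MvPolynomial V K).support, ∀ v, (b v : ℤ) = a v}
  zero_mem' := by simp
  add_mem' := by
    classical
    intro f g hf hg b hb
    rcases Finset.mem_union.1 (MvPolynomial.support_add hb) with h | h
    · exact hf b h
    · exact hg b h
  smul_mem' := by
    intro c f hf b hb
    exact hf b (MvPolynomial.support_smul hb)

section GradedModule

variable {K : Type*} [Field K] {V : Type*} {M : Type*} [AddCommGroup M]
  [Module K M] [Module (MvPolynomial V K) M] [IsScalarTower K (MvPolynomial V K) M]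

/-- The `K`-linear subspace `u K[Z]` of `M`: all elements `f • u` with `f ∈ K[Z]`. -/
def stanleySpace (u : M) (Z : Finset V) : Submodule K M :=
  (Subalgebra.toSubmodule (MvPolynomial.supported K (Z : Set V))).map
    ((LinearMap.toSpanSingleton (MvPolynomial V K) M u).restrictScalars K)

/-- A Stanley decomposition of a `ℤ^V`-graded `K[x_v : v ∈ V]`-module `M` with graded components
`𝓜 a`: finitely many homogeneous elements `u i` and sets of variables `Z i` such that each
`u i K[Z i]` is a free `K[Z i]`-module on `u i` and `M` is the direct sum of these `K`-subspaces. -/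
structure StanleyDecomposition (𝓜 : (V → ℤ) → Submodule K M) where
  r : ℕ
  u : Fin r → M
  Z : Fin r → Finset V
  homogeneous : ∀ i, ∃ a, u i ∈ 𝓜 a
  free : ∀ i, ∀ f ∈ MvPolynomial.supported K (Z i : Set V), f • u i = 0 → f = 0
  isInternal : DirectSum.IsInternal fun i => (stanleySpace (u i) (Z i) : Submodule K M)

/-- The Stanley depth of a decomposition: the minimum of the numbers `|Z i|`. (It is `⊤` only for
the empty decomposition of the zero module.) -/
def StanleyDecomposition.sdepth {𝓜 : (V → ℤ) → Submodule K M}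
    (D : StanleyDecomposition 𝓜) : ℕ∞ :=
  ⨅ i, ((D.Z i).card : ℕ∞)

/-- The Stanley depth of a graded module: the maximum over all its Stanley decompositions. -/
def sdepth (𝓜 : (V → ℤ) → Submodule K M) : ℕ∞ :=
  ⨆ D : StanleyDecomposition 𝓜, D.sdepth

end GradedModule

/-- The depth of a module `M` over `K[x_v : v ∈ V]`: the maximal length of an `M`-regular sequence
contained in the graded maximal ideal `(x_v : v ∈ V)`. -/
def polyDepth (K : Type*) [Field K] (V : Type*) (M : Type*) [AddCommGroup M]
    [Module (MvPolynomial V K) M] : ℕ∞ :=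
  ⨆ rs : {rs : List (MvPolynomial V K) //
      (∀ f ∈ rs, f ∈ Ideal.span (Set.range (MvPolynomial.X : V → MvPolynomial V K))) ∧
      RingTheory.Sequence.IsRegular M rs},
    (rs.1.length : ℕ∞)

end

/-! The proof shows depth ≤ 2 ≤ sdepth.

For sdepth, each monomial of $I$ meets at least two classes. Sort it by $(u,v)$: $v$ is its least
variable in the highest class it meets, $u$ its least variable in lower classes. Each pair gives one
piece $x_ux_vK[Z]$ with $u,v\in Z$ (`two_le_sdepth_edgeIdeal`).

For depth, the zero locus of $I$ is a union of coordinate subspaces, one per class, meeting only at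
the origin. The projection $\rho$ to one class acts like an idempotent of the punctured locus. A
third regular element would lift it to a polynomial $a$ equal to 1 on one subspace and 0 on another,
contradicting its constant term (`length_le_two_of_isWeaklyRegular_edgeIdeal`). -/

open MvPolynomial

/-! ### Stanley decompositions from partitions of exponents -/

section StanleyPartition

variable {K : Type*} [Field K] {V : Type*}

/-- Every monomial of an element of `x^m K[Z]` lies in `m + ℕ^Z`. -/
theorem exists_add_of_mem_support_of_mem_stanleySpace {I : Ideal (MvPolynomial V K)}
    {m : V →₀ ℕ} (hm : monomial m (1 : K) ∈ I) {Z : Finset V} {x : I}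
    (hx : x ∈ stanleySpace (K := K) (⟨monomial m 1, hm⟩ : I) Z) {b : V →₀ ℕ}
    (hb : b ∈ (x : MvPolynomial V K).support) :
    ∃ d : V →₀ ℕ, d.support ⊆ Z ∧ b = d + m := by
  obtain ⟨f, hf, rfl⟩ := hx
  have hf' : ↑f.vars ⊆ (Z : Set V) := mem_supported.1 hf
  have hc : coeff b (f * monomial m (1 : K)) ≠ 0 := mem_support_iff.1 hb
  rw [coeff_mul_monomial', mul_one] at hc
  split_ifs at hc with hle
  · refine ⟨b - m, fun v hv => ?_, (tsub_add_cancel_of_le hle).symm⟩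
    exact_mod_cast hf' (by
      exact_mod_cast (mem_vars_iff_mem_support v).2 ⟨b - m, mem_support_iff.2 hc, hv⟩)
  · exact absurd rfl hc

theorem smul_mem_stanleySpace {I : Ideal (MvPolynomial V K)} {u : I} {Z : Finset V}
    {d : V →₀ ℕ} (hd : d.support ⊆ Z) (a : K) :
    monomial d a • u ∈ stanleySpace (K := K) u Z := by
  classical
  refine ⟨monomial d a, ?_, rfl⟩
  refine mem_supported.2 fun v hv => ?_
  obtain ⟨e, he, hve⟩ := (mem_vars_iff_mem_support v).1 (by exact_mod_cast hv)
  rw [Finset.mem_singleton.1 (support_monomial_subset he)] at hve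
  exact_mod_cast hd hve

/-- If the exponents of the monomials of an ideal are partitioned into finitely many sets
`m i + ℕ^(Z i)`, then the smallest `|Z i|` bounds the Stanley depth from below. -/
theorem le_sdepth_of_partition {ι : Type*} [Finite ι] {I : Ideal (MvPolynomial V K)}
    (m : ι → V →₀ ℕ) (Z : ι → Finset V) (hm : ∀ i, monomial (m i) (1 : K) ∈ I)
    (hcover : ∀ f ∈ I, ∀ b ∈ f.support, ∃ i, ∃ d : V →₀ ℕ, d.support ⊆ Z i ∧ b = d + m i)
    (hdisj : ∀ i j (d e : V →₀ ℕ), d.support ⊆ Z i → e.support ⊆ Z j →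
      d + m i = e + m j → i = j)
    {n : ℕ} (hn : ∀ i, n ≤ (Z i).card) : (n : ℕ∞) ≤ sdepth (idealGrading I) := by
  classical
  obtain ⟨r, ⟨φ⟩⟩ := Finite.exists_equiv_fin ι
  let u : Fin r → I := fun i => ⟨monomial (m (φ.symm i)) 1, hm _⟩
  have hsup : ∀ (i : Fin r) (x : I), x ∈ stanleySpace (K := K) (u i) (Z (φ.symm i)) →
      ∀ b ∈ (x : MvPolynomial V K).support,
        ∃ d : V →₀ ℕ, d.support ⊆ Z (φ.symm i) ∧ b = d + m (φ.symm i) :=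
    fun i x hx b hb => exists_add_of_mem_support_of_mem_stanleySpace _ hx hb
  let D : StanleyDecomposition (idealGrading I) :=
    { r := r
      u := u
      Z := fun i => Z (φ.symm i)
      homogeneous := fun i => ⟨fun v => (m (φ.symm i) v : ℤ), fun b hb v => by
        rw [Finset.mem_singleton.1 (support_monomial_subset hb)]⟩
      free := fun i f _ h => by
        have h' : f * monomial (m (φ.symm i)) (1 : K) = 0 := congrArg Subtype.val h
        exact (mul_eq_zero.1 h').resolve_right (by simp)
      isInternal := by
        refine DirectSum.isInternal_submodule_of_iSupIndep_of_iSup_eq_top ?_ ?_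
        · refine iSupIndep_def.2 fun i => Submodule.disjoint_def.2 fun x hx hx' => ?_
          -- The other pieces are supported on exponents outside piece `i`, so a common element has
          -- empty support.
          have hle : (⨆ j, ⨆ (_ : j ≠ i), stanleySpace (K := K) (u j) (Z (φ.symm j))) ≤
              ((restrictSupport K {b | ∀ d : V →₀ ℕ, d.support ⊆ Z (φ.symm i) →
                b ≠ d + m (φ.symm i)}).comap (I.subtype.restrictScalars K)) := by
            refine iSup₂_le fun j hj y hy => ?_
            refine (mem_restrictSupport_iff K).2 fun b hb d hd hbd => ?_
            obtain ⟨e, he, hbe⟩ := hsup j y hy b hb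
            exact hj (φ.symm.injective (hdisj _ _ e d he hd (hbe.symm.trans hbd)))
          have h0 : (x : MvPolynomial V K).support = ∅ := by
            refine Finset.eq_empty_of_forall_notMem fun b hb => ?_
            obtain ⟨d, hd, hbd⟩ := hsup i x hx b hb
            exact (mem_restrictSupport_iff K).1 (hle hx') hb d hd hbd
          exact Subtype.ext (support_eq_empty.1 h0)
        · refine eq_top_iff.2 fun x _ => ?_
          have hterm : ∀ b ∈ (x : MvPolynomial V K).support, ∃ y : I,
              y ∈ (⨆ i, stanleySpace (K := K) (u i) (Z (φ.symm i))) ∧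
              (y : MvPolynomial V K) = monomial b (coeff b (x : MvPolynomial V K)) := by
            intro b hb
            obtain ⟨i, d, hd, rfl⟩ := hcover x x.2 b hb
            refine ⟨monomial d (coeff (d + m i) (x : MvPolynomial V K)) • u (φ i),
              Submodule.mem_iSup_of_mem (φ i) (smul_mem_stanleySpace (by simpa using hd) _), ?_⟩
            simp [u, monomial_mul]
          choose! y hy hyx using hterm
          have hx : x = ∑ b ∈ (x : MvPolynomial V K).support, y b := by
            apply Subtype.ext
            rw [AddSubmonoidClass.coe_finsetSum, Finset.sum_congr rfl hyx]
            exact (x : MvPolynomial V K).as_sum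
          rw [hx]
          exact Submodule.sum_mem _ hy }
  refine le_trans ?_ (le_iSup (fun D : StanleyDecomposition (idealGrading I) => D.sdepth) D)
  exact le_iInf fun i => by exact_mod_cast hn (φ.symm i)

end StanleyPartition

/-! ### Stanley depth at least two -/

section CompleteMultipartite

/-- The classes of a complete `k`-partite graph are the fibres of a surjective colouring. -/
theorem IsCompleteKPartite.exists_coloring {V : Type*} {k : ℕ} {G : SimpleGraph V}
    (hG : IsCompleteKPartite k G) :
    ∃ c : V → Fin k, Function.Surjective c ∧ ∀ u v, G.Adj u v ↔ c u ≠ c v := by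
  obtain ⟨P, hne, hdisj, hcov, hadj⟩ := hG
  have hex : ∀ v, ∃ i, v ∈ P i := fun v => by
    simpa using (Set.ext_iff.1 hcov v).2 trivial
  choose c hc using hex
  have huniq : ∀ v i, v ∈ P i → c v = i := fun v i hv => by
    by_contra h
    exact Set.disjoint_left.1 (hdisj _ _ h) (hc v) hv
  refine ⟨c, fun i => ?_, fun u v => ?_⟩
  · obtain ⟨v, hv⟩ := hne i
    exact ⟨v, huniq v i hv⟩
  · rw [hadj]
    constructor
    · rintro ⟨i, j, hij, hu, hv⟩
      rwa [huniq u i hu, huniq v j hv]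
    · exact fun h => ⟨c u, c v, h, hc u, hc v⟩

variable {K : Type*} [Field K] {V : Type*} {k : ℕ} {G : SimpleGraph V} {c : V → Fin k}

theorem X_mul_X_mem_edgeIdeal (hc : ∀ u v, G.Adj u v ↔ c u ≠ c v) {u v : V} (h : c u ≠ c v) :
    (X u * X v : MvPolynomial V K) ∈ edgeIdeal K G :=
  Ideal.subset_span ⟨u, v, (hc u v).2 h, rfl⟩

theorem exists_ne_of_mem_support_of_mem_edgeIdeal (hc : ∀ u v, G.Adj u v ↔ c u ≠ c v)
    {f : MvPolynomial V K} (hf : f ∈ edgeIdeal K G) {b : V →₀ ℕ} (hb : b ∈ f.support) :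
    ∃ u v, c u < c v ∧ b u ≠ 0 ∧ b v ≠ 0 := by
  have hle : edgeIdeal K G ≤ Ideal.span ((fun s => monomial s (1 : K)) ''
      {s | ∃ u v, c u ≠ c v ∧ s = Finsupp.single u 1 + Finsupp.single v 1}) := by
    refine Ideal.span_mono ?_
    rintro _ ⟨u, v, huv, rfl⟩
    exact ⟨_, ⟨u, v, (hc u v).1 huv, rfl⟩, by simp [X, monomial_mul]⟩
  obtain ⟨_, ⟨u, v, huv, rfl⟩, hs⟩ := mem_ideal_span_monomial_image.1 (hle hf) b hb
  have hu := hs u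
  have hv := hs v
  simp only [Finsupp.add_apply, Finsupp.single_eq_same] at hu hv
  rcases lt_or_gt_of_ne huv with h | h
  · exact ⟨u, v, h, by omega, by omega⟩
  · exact ⟨v, u, h, by omega, by omega⟩

theorem two_le_sdepth_edgeIdeal [Finite V] (hc : ∀ u v, G.Adj u v ↔ c u ≠ c v) :
    2 ≤ sdepth (idealGrading (edgeIdeal K G)) := by
  classical
  obtain ⟨n, ⟨φ⟩⟩ := Finite.exists_equiv_fin V
  -- Any linear order serves; it need not be compatible with the classes.
  let : LinearOrder V := LinearOrder.lift' φ φ.injective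
  let := Fintype.ofFinite V
  let m : {p : V × V // c p.1 < c p.2} → V →₀ ℕ :=
    fun p => Finsupp.single p.1.1 1 + Finsupp.single p.1.2 1
  -- Exactly the variables that can be added without changing the sorting pair `p`.
  let Z : {p : V × V // c p.1 < c p.2} → Finset V := fun p =>
    {w | (c w < c p.1.2 ∧ p.1.1 ≤ w) ∨ (c w = c p.1.2 ∧ p.1.2 ≤ w)}
  have hmZ : ∀ p, (m p).support ⊆ Z p := by
    rintro ⟨⟨u, v⟩, huv⟩ w hw
    simp only [m, Z, Finsupp.mem_support_iff, Finsupp.add_apply, Finsupp.single_apply,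
      Finset.mem_filter_univ] at hw ⊢
    by_cases h1 : u = w
    · subst h1; exact Or.inl ⟨huv, le_rfl⟩
    · by_cases h2 : v = w
      · subst h2; exact Or.inr ⟨rfl, le_rfl⟩
      · simp [h1, h2] at hw
  -- the support of an exponent in the piece of `p` lies in `Z p` and contains both entries of `p`
  have hsupp : ∀ p (d : V →₀ ℕ), d.support ⊆ Z p → (d + m p).support ⊆ Z p := fun p d hd =>
    Finsupp.support_add.trans (Finset.union_subset hd (hmZ p))
  have hfst : ∀ p (d : V →₀ ℕ), p.1.1 ∈ (d + m p).support := fun p d => by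
    simp [m]
  have hsnd : ∀ p (d : V →₀ ℕ), p.1.2 ∈ (d + m p).support := fun p d => by
    simp [m]
  refine le_sdepth_of_partition m Z ?_ ?_ ?_ ?_
  · intro p
    have := X_mul_X_mem_edgeIdeal (K := K) hc p.2.ne
    simpa [X, monomial_mul] using this
  · intro f hf b hb
    obtain ⟨u₀, v₀, h₀, hu₀, hv₀⟩ := exists_ne_of_mem_support_of_mem_edgeIdeal hc hf hb
    obtain ⟨t, ht, htmax⟩ := b.support.exists_max_image c ⟨v₀, by simpa using hv₀⟩
    obtain ⟨v, hv, hvmin⟩ := (b.support.filter (c · = c t)).exists_min_image id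
      ⟨t, by simpa using ht⟩
    obtain ⟨u, hu, humin⟩ := (b.support.filter (c · < c t)).exists_min_image id
      ⟨u₀, by simpa using ⟨hu₀, h₀.trans_le (htmax v₀ (by simpa using hv₀))⟩⟩
    simp only [Finset.mem_filter, id] at hv hvmin hu humin
    have huv : c u < c v := hv.2 ▸ hu.2
    have hle : m ⟨(u, v), huv⟩ ≤ b := by
      intro w
      have h1 := Finsupp.mem_support_iff.1 hv.1
      have h2 := Finsupp.mem_support_iff.1 hu.1
      have h3 : u ≠ v := fun h => by simp [h] at huv
      simp only [m, Finsupp.add_apply, Finsupp.single_apply]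
      split_ifs with h4 h5 h5
      · exact absurd (h4.trans h5.symm) h3
      · subst h4; omega
      · subst h5; omega
      · omega
    refine ⟨⟨(u, v), huv⟩, b - m ⟨(u, v), huv⟩, fun w hw => ?_, (tsub_add_cancel_of_le hle).symm⟩
    have hw' : w ∈ b.support := by
      simp only [Finsupp.mem_support_iff, Finsupp.tsub_apply] at hw ⊢
      omega
    simp only [Z, Finset.mem_filter_univ, hv.2]
    rcases (htmax w hw').lt_or_eq with h | h
    · exact Or.inl ⟨h, humin w ⟨hw', h⟩⟩
    · exact Or.inr ⟨h, hvmin w ⟨hw', h⟩⟩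
  · rintro p q d e hd he h
    have hpq := hsupp q e he (h ▸ hfst p d)
    have hpq' := hsupp q e he (h ▸ hsnd p d)
    have hqp := hsupp p d hd (h ▸ hfst q e)
    have hqp' := hsupp p d hd (h ▸ hsnd q e)
    obtain ⟨⟨u, v⟩, huv⟩ := p
    obtain ⟨⟨u', v'⟩, huv'⟩ := q
    simp only [Z, Finset.mem_filter_univ] at hpq hpq' hqp hqp' huv huv'
    -- Both pairs lie in both sets `Z`, so each extremality condition holds in both directions.
    have hcv : c v = c v' := by
      apply le_antisymm
      · rcases hpq' with h | h
        exacts [h.1.le, h.1.le]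
      · rcases hqp' with h | h
        exacts [h.1.le, h.1.le]
    have hv : v = v' := by
      rcases hpq' with h | h
      · exact absurd hcv h.1.ne
      · rcases hqp' with h' | h'
        · exact absurd hcv.symm h'.1.ne
        · exact le_antisymm h'.2 h.2
    subst hv
    have hu : u = u' := by
      rcases hpq with h | h
      · rcases hqp with h' | h'
        · exact le_antisymm h'.2 h.2
        · exact absurd h'.1 huv'.ne
      · exact absurd h.1 huv.ne
    subst hu
    rfl
  · intro p
    refine le_trans ?_ (Finset.card_le_card (hmZ p))
    have h : p.1.1 ≠ p.1.2 := fun h => p.2.ne (congrArg c h)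
    refine (Finset.card_pair h).ge.trans ?_
    refine Finset.card_le_card fun w hw => ?_
    rcases Finset.mem_insert.1 hw with rfl | hw
    · simp [m]
    · rw [Finset.mem_singleton.1 hw]; simp [m]

end CompleteMultipartite

/-! ### Regular sequences on an ideal -/

section RegularSequence

variable {R : Type*} [CommRing R] {I : Ideal R} {f g h : R} {l : List R}

open RingTheory.Sequence

theorem RingTheory.Sequence.IsWeaklyRegular.eq_zero_of_mul_eq_zero
    (H : IsWeaklyRegular I (f :: l)) {x : R} (hx : x ∈ I) (h0 : f * x = 0) : x = 0 :=
  congrArg Subtype.val (((isWeaklyRegular_cons_iff I f l).1 H).1.right_eq_zero_of_smul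
    (x := ⟨x, hx⟩) (Subtype.ext h0))

theorem mem_ofList_singleton_smul_top_iff {x : I} :
    x ∈ (Ideal.ofList [f] • ⊤ : Submodule R I) ↔ ∃ y ∈ I, (x : R) = f * y := by
  rw [Ideal.ofList_singleton, Submodule.ideal_span_singleton_smul,
    Submodule.mem_smul_pointwise_iff_exists]
  constructor
  · rintro ⟨y, -, rfl⟩
    exact ⟨y, y.2, rfl⟩
  · rintro ⟨y, hy, hxy⟩
    exact ⟨⟨y, hy⟩, trivial, Subtype.ext hxy.symm⟩

theorem mem_ofList_pair_smul_top_iff {x : I} :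
    x ∈ (Ideal.ofList [f, g] • ⊤ : Submodule R I) ↔
      ∃ y ∈ I, ∃ z ∈ I, (x : R) = f * y + g * z := by
  rw [Ideal.ofList_cons, Submodule.sup_smul, ← Ideal.ofList_singleton, Submodule.mem_sup]
  simp only [mem_ofList_singleton_smul_top_iff]
  constructor
  · rintro ⟨_, ⟨y, hy, hy'⟩, _, ⟨z, hz, hz'⟩, rfl⟩
    exact ⟨y, hy, z, hz, by simp [hy', hz']⟩
  · rintro ⟨y, hy, z, hz, h⟩
    exact ⟨⟨f * y, I.mul_mem_left _ hy⟩, ⟨y, hy, rfl⟩, ⟨g * z, I.mul_mem_left _ hz⟩,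
      ⟨z, hz, rfl⟩, Subtype.ext h.symm⟩

theorem RingTheory.Sequence.IsWeaklyRegular.exists_eq_mul_of_second
    (H : IsWeaklyRegular I (f :: g :: l)) {x : R} (hx : x ∈ I)
    (hgx : ∃ y ∈ I, g * x = f * y) : ∃ y ∈ I, x = f * y := by
  have := (isSMulRegular_quotient_iff_mem_of_smul_mem _ _).1
    (H.regular_mod_prev 1 (by simp)) ⟨x, hx⟩
  exact mem_ofList_singleton_smul_top_iff.1 (this (mem_ofList_singleton_smul_top_iff.2 hgx))

theorem RingTheory.Sequence.IsWeaklyRegular.exists_eq_mul_add_mul_of_third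
    (H : IsWeaklyRegular I (f :: g :: h :: l)) {x : R} (hx : x ∈ I)
    (hhx : ∃ y ∈ I, ∃ z ∈ I, h * x = f * y + g * z) : ∃ y ∈ I, ∃ z ∈ I, x = f * y + g * z := by
  have := (isSMulRegular_quotient_iff_mem_of_smul_mem _ _).1
    (H.regular_mod_prev 2 (by simp)) ⟨x, hx⟩
  exact mem_ofList_pair_smul_top_iff.1 (this (mem_ofList_pair_smul_top_iff.2 hhx))

/-- The first two terms of a sequence that is weakly regular on a nonzero ideal have no common
factor. -/
theorem RingTheory.Sequence.IsWeaklyRegular.isRelPrime [IsDomain R] [WfDvdMonoid R]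
    (H : IsWeaklyRegular I (f :: g :: l)) (hI : I ≠ ⊥) : IsRelPrime f g := by
  obtain ⟨u, hu, hu0⟩ := Submodule.exists_mem_ne_zero_of_ne_bot hI
  rintro d ⟨f', rfl⟩ ⟨g', rfl⟩
  have hd : d * f' ≠ 0 := fun h => hu0 (H.eq_zero_of_mul_eq_zero hu (by rw [h, zero_mul]))
  have hf' := right_ne_zero_of_mul hd
  -- From $g\cdot f'x = f\cdot g'x$, regularity gives $f'x\in fI$; cancelling $f'$ yields $I=dI$,
  -- hence $I=d^nI$ for all $n$.
  have hdiv : ∀ x ∈ I, ∃ y ∈ I, x = d * y := by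
    intro x hx
    obtain ⟨y, hy, hxy⟩ := H.exists_eq_mul_of_second (I.mul_mem_left f' hx)
      ⟨g' * x, I.mul_mem_left _ hx, by ring⟩
    exact ⟨y, hy, mul_left_cancel₀ hf' (by rw [hxy]; ring)⟩
  have hpow : ∀ n : ℕ, ∀ x ∈ I, d ^ n ∣ x := by
    intro n
    induction n with
    | zero => simp
    | succ n ih =>
      intro x hx
      obtain ⟨y, hy, rfl⟩ := hdiv x hx
      rw [pow_succ']
      exact mul_dvd_mul_left d (ih y hy)
  by_contra hunit
  obtain ⟨n, hn⟩ := FiniteMultiplicity.of_not_isUnit hunit hu0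
  exact hn (hpow _ u hu)

end RegularSequence

/-! ### Depth at most two -/

section ClassProjection

variable {K : Type*} [Field K] {V : Type*} {k : ℕ} {G : SimpleGraph V} {c : V → Fin k}

/-- The endomorphism of `K[x_v : v ∈ V]` that sets the variables outside the class `i` to zero. -/
noncomputable def classProjection (K : Type*) [Field K] {V : Type*} {k : ℕ} (c : V → Fin k) (i : Fin k) :
    MvPolynomial V K →ₐ[K] MvPolynomial V K :=
  aeval fun v => if c v = i then X v else 0

theorem classProjection_X (i : Fin k) (v : V) :
    classProjection K c i (X v) = if c v = i then X v else 0 := by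
  simp [classProjection]

theorem constantCoeff_classProjection (i : Fin k) (f : MvPolynomial V K) :
    constantCoeff (classProjection K c i f) = constantCoeff f := by
  induction f using MvPolynomial.induction_on with
  | C a => rw [← algebraMap_eq, AlgHom.commutes]
  | add p q hp hq => simp only [map_add, hp, hq]
  | mul_X p v hp =>
    rw [map_mul, map_mul, map_mul, classProjection_X]
    split_ifs <;> simp

theorem classProjection_eq_zero_of_mem_edgeIdeal (hc : ∀ u v, G.Adj u v ↔ c u ≠ c v) (i : Fin k)
    {f : MvPolynomial V K} (hf : f ∈ edgeIdeal K G) : classProjection K c i f = 0 := by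
  have hle : edgeIdeal K G ≤ RingHom.ker (classProjection K c i) := by
    refine Ideal.span_le.2 ?_
    rintro _ ⟨u, v, huv, rfl⟩
    have hne := (hc u v).1 huv
    rw [SetLike.mem_coe, RingHom.mem_ker, map_mul, classProjection_X, classProjection_X]
    split_ifs with h1 h2
    · exact absurd (h1.trans h2.symm) hne
    all_goals simp
  exact hle hf

theorem sub_classProjection_mem_span (i : Fin k) (f : MvPolynomial V K) :
    f - classProjection K c i f ∈ Ideal.span (X '' {v | c v ≠ i}) := by
  induction f using MvPolynomial.induction_on with
  | C a => rw [← algebraMap_eq, AlgHom.commutes, sub_self]; exact zero_mem _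
  | add p q hp hq => rw [map_add, add_sub_add_comm]; exact add_mem hp hq
  | mul_X p v hp =>
    rw [map_mul, classProjection_X]
    split_ifs with h
    · rw [← sub_mul]
      exact Ideal.mul_mem_right _ _ hp
    · rw [mul_zero, sub_zero]
      exact Ideal.mul_mem_left _ _ (Ideal.subset_span ⟨v, h, rfl⟩)

theorem classProjection_mem_span (i : Fin k) {f : MvPolynomial V K}
    (hf : f ∈ Ideal.span (Set.range (X : V → MvPolynomial V K))) :
    classProjection K c i f ∈ Ideal.span (X '' {v | c v = i}) := by
  have hle : Ideal.span (Set.range (X : V → MvPolynomial V K)) ≤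
      (Ideal.span (X '' {v | c v = i})).comap (classProjection K c i) := by
    refine Ideal.span_le.2 ?_
    rintro _ ⟨v, rfl⟩
    rw [SetLike.mem_coe, Ideal.mem_comap, classProjection_X]
    split_ifs with h
    · exact Ideal.subset_span ⟨v, h, rfl⟩
    · exact zero_mem _
  exact hle hf

/-- The first factor lies in the ideal of the variables outside class `i`, the second, since `g` has
no constant term, in that of the variables inside; products of such variables are edges. -/
theorem sub_classProjection_mul_classProjection_mem_edgeIdeal
    (hc : ∀ u v, G.Adj u v ↔ c u ≠ c v) (i : Fin k) (f : MvPolynomial V K)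
    {g : MvPolynomial V K} (hg : g ∈ Ideal.span (Set.range (X : V → MvPolynomial V K))) :
    (f - classProjection K c i f) * classProjection K c i g ∈ edgeIdeal K G := by
  have hmem := Ideal.mul_mem_mul (sub_classProjection_mem_span (c := c) i f)
    (classProjection_mem_span (c := c) i hg)
  rw [Ideal.span_mul_span'] at hmem
  refine Ideal.span_le.2 ?_ hmem
  rintro _ ⟨_, ⟨u, hu, rfl⟩, _, ⟨v, hv, rfl⟩, rfl⟩
  exact X_mul_X_mem_edgeIdeal hc fun h => hu (h.trans hv)

theorem X_mul_mem_edgeIdeal (hc : ∀ u v, G.Adj u v ↔ c u ≠ c v) (w : V) {f : MvPolynomial V K}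
    (hf : classProjection K c (c w) f = 0) : X w * f ∈ edgeIdeal K G := by
  have h := sub_classProjection_mul_classProjection_mem_edgeIdeal hc (c w) f
    (g := X w) (Ideal.subset_span ⟨w, rfl⟩)
  rwa [hf, sub_zero, classProjection_X, if_pos rfl, mul_comm] at h

theorem X_notMem_edgeIdeal (hc : ∀ u v, G.Adj u v ↔ c u ≠ c v) (w : V) :
    (X w : MvPolynomial V K) ∉ edgeIdeal K G := by
  intro h
  have := classProjection_eq_zero_of_mem_edgeIdeal hc (c w) h
  rw [classProjection_X, if_pos rfl] at this
  exact X_ne_zero w this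

open RingTheory.Sequence

/-- The first two terms of a weakly regular sequence on the edge ideal do not both lie in the
prime generated by the variables outside one class. -/
theorem not_classProjection_eq_zero_of_isWeaklyRegular (hc : ∀ u v, G.Adj u v ↔ c u ≠ c v)
    {f g : MvPolynomial V K} {l : List (MvPolynomial V K)}
    (H : IsWeaklyRegular (edgeIdeal K G) (f :: g :: l)) (hf0 : f ≠ 0) (w : V)
    (hf : classProjection K c (c w) f = 0) (hg : classProjection K c (c w) g = 0) : False := by
  -- Since $g\cdot x_wf=f\cdot x_wg$ with both products in $I$, regularity gives $x_wf\in fI$, hence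
  -- $x_w\in I$.
  obtain ⟨y, hy, h⟩ := H.exists_eq_mul_of_second (X_mul_mem_edgeIdeal hc w hf)
    ⟨X w * g, X_mul_mem_edgeIdeal hc w hg, by ring⟩
  rw [mul_comm] at h
  exact X_notMem_edgeIdeal hc w (mul_left_cancel₀ hf0 h ▸ hy)

theorem length_le_two_of_isWeaklyRegular_edgeIdeal (hc : ∀ u v, G.Adj u v ↔ c u ≠ c v)
    {w₁ w₂ : V} (hw : c w₁ ≠ c w₂) {rs : List (MvPolynomial V K)}
    (hrs : ∀ f ∈ rs, f ∈ Ideal.span (Set.range (X : V → MvPolynomial V K)))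
    (H : IsWeaklyRegular (edgeIdeal K G) rs) : rs.length ≤ 2 := by
  match rs, hrs, H with
  | [], _, _ => simp
  | [_], _, _ => simp
  | [_, _], _, _ => simp
  | f :: g :: h :: l, hrs, H =>
    exfalso
    have hf := hrs f (by simp)
    have hg := hrs g (by simp)
    have hh := hrs h (by simp)
    have hedge := X_mul_X_mem_edgeIdeal (K := K) hc hw
    have hne : (X w₁ * X w₂ : MvPolynomial V K) ≠ 0 := mul_ne_zero (X_ne_zero _) (X_ne_zero _)
    have hI : edgeIdeal K G ≠ ⊥ := fun h => hne (by rwa [h, Ideal.mem_bot] at hedge)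
    have hf0 : f ≠ 0 := fun h => hne (H.eq_zero_of_mul_eq_zero hedge (by rw [h, zero_mul]))
    set ρ := classProjection K c (c w₁) with hρ
    have hcocycle : ∀ {p q : MvPolynomial V K},
        p ∈ Ideal.span (Set.range (X : V → MvPolynomial V K)) →
        q ∈ Ideal.span (Set.range (X : V → MvPolynomial V K)) →
        p * ρ q - q * ρ p ∈ edgeIdeal K G := by
      intro p q hp hq
      have := sub_mem (sub_classProjection_mul_classProjection_mem_edgeIdeal hc (c w₁) p hq)
        (sub_classProjection_mul_classProjection_mem_edgeIdeal hc (c w₁) q hp)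
      convert this using 1
      ring
    -- Multiplied by `h`, the element $f\rho(g)-g\rho(f)$ is a combination of `f` and `g` with
    -- coefficients in $I$, so it already is one itself.
    obtain ⟨p, hp, q, hq, hpq⟩ := H.exists_eq_mul_add_mul_of_third (hcocycle hf hg)
      ⟨h * ρ g - g * ρ h, hcocycle hh hg,
        f * ρ h - h * ρ f, hcocycle hf hh, by ring⟩
    -- Now $f(\rho g-p)=g(\rho f+q)$ with $f,g$ coprime; the common quotient `a` is the lifted
    -- idempotent.
    have hdvd : f ∣ ρ f + q :=
      (H.isRelPrime hI).dvd_of_dvd_mul_left ⟨ρ g - p, by linear_combination -hpq⟩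
    obtain ⟨a, ha⟩ := hdvd
    have hga : ρ g - p = g * a := mul_left_cancel₀ hf0 (by linear_combination hpq + g * ha)
    have hρρ : ∀ x, ρ (ρ x) = ρ x := by
      intro x
      have : (ρ.comp ρ) = ρ := by
        ext v : 1
        simp only [AlgHom.comp_apply, hρ, classProjection_X]
        split_ifs with h
        · rw [classProjection_X, if_pos h]
        · simp
      exact DFunLike.congr_fun this x
    have hvan := fun i {x} hx => classProjection_eq_zero_of_mem_edgeIdeal (K := K) (f := x) hc i hx
    -- If $\rho a=1$, then `a` has constant term 1 and is nonzero on the class of `w₂`, where $\rho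
    -- f$, $\rho g$, `p` and `q` vanish; so `f` and `g` vanish there. Otherwise $\rho f\,(1-\rho
    -- a)=0$ and its analogue for `g` make both vanish on the class of `w₁`.
    by_cases h1 : ρ a = 1
    · have ha0 : classProjection K c (c w₂) a ≠ 0 := by
        intro h2
        have e1 := constantCoeff_classProjection (c := c) (c w₁) a
        have e2 := constantCoeff_classProjection (c := c) (c w₂) a
        rw [← hρ, h1] at e1
        rw [h2, ← e1] at e2
        simp at e2
      have hcross : ∀ x, x ∈ Ideal.span (Set.range (X : V → MvPolynomial V K)) →
          classProjection K c (c w₂) (ρ x) = 0 := by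
        intro x hx
        have hle : Ideal.span (X '' {v | c v = c w₁}) ≤
            RingHom.ker (classProjection K c (c w₂)) := by
          refine Ideal.span_le.2 ?_
          rintro _ ⟨v, hv, rfl⟩
          rw [SetLike.mem_coe, RingHom.mem_ker, classProjection_X, if_neg]
          exact fun h => hw (hv.symm.trans h)
        exact hle (classProjection_mem_span _ hx)
      refine not_classProjection_eq_zero_of_isWeaklyRegular hc H hf0 w₂ ?_ ?_
      · have := congrArg (classProjection K c (c w₂)) ha
        rw [map_add, hcross f hf, hvan _ hq, map_mul, add_zero] at this
        exact (mul_eq_zero.1 this.symm).resolve_right ha0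
      · have := congrArg (classProjection K c (c w₂)) hga
        rw [map_sub, hcross g hg, hvan _ hp, map_mul, sub_zero] at this
        exact (mul_eq_zero.1 this.symm).resolve_right ha0
    · have h1' : 1 - ρ a ≠ 0 := fun h => h1 (sub_eq_zero.1 h).symm
      refine not_classProjection_eq_zero_of_isWeaklyRegular hc H hf0 w₁ ?_ ?_
      · have := congrArg ρ ha
        rw [map_add, hρρ, hρ, hvan _ hq, map_mul, add_zero, ← hρ] at this
        exact (mul_eq_zero.1 (show ρ f * (1 - ρ a) = 0 by linear_combination this)).resolve_right h1'
      · have := congrArg ρ hga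
        rw [map_sub, hρρ, hρ, hvan _ hp, map_mul, sub_zero, ← hρ] at this
        exact (mul_eq_zero.1 (show ρ g * (1 - ρ a) = 0 by linear_combination this)).resolve_right h1'

end ClassProjection

theorem corollary2p8 {K : Type*} [Field K] {V : Type*} [Finite V] (k : ℕ) (hk : 2 ≤ k)
    (G : SimpleGraph V) (hG : IsCompleteKPartite k G) :
    polyDepth K V (edgeIdeal K G) ≤ sdepth (idealGrading (edgeIdeal K G)) := by
  obtain ⟨c, hsurj, hc⟩ := hG.exists_coloring
  obtain ⟨w₁, h₁⟩ := hsurj ⟨0, by omega⟩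
  obtain ⟨w₂, h₂⟩ := hsurj ⟨1, by omega⟩
  have hw : c w₁ ≠ c w₂ := by simp [h₁, h₂]
  refine le_trans (iSup_le fun rs => ?_) (two_le_sdepth_edgeIdeal hc)
  exact_mod_cast length_le_two_of_isWeaklyRegular_edgeIdeal hc hw rs.2.1
    rs.2.2.toIsWeaklyRegular
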